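/- Let $D$ be a division ring and let $V$ be a right vector space over $D$ (of arbitrary, possibly infinite, dimension). Then the following are equivalent: 1. for every $D$-linear transformation $T : V \to V$ there exists an invertible $D$-linear transformation $S : V \to V$ such that both $T - S$ and $T + S$ are invertible; 2. it is not the case that $V$ is one-dimensional over $D$ and $D$ is isomorphic, as a ring, to $\mathbb{Z}_2$ or $\mathbb{Z}_3$ (the fields with two and three elements). In other words, for every linear transformation $T$ of $V$ there is an invertible linear transformation $S$ of $V$ such that $T-S$ and $T+S$ are both invertible, and the only exceptional spaces, for which this fails for some $T$, are the one-dimensional spaces over $\mathbb{Z}_2$ and over $\mathbb{Z}_3$. -/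

import Mathlib

open Cardinal

universe u v

/-! The property survives independent changes of basis in source and target, so `T` may be replaced
by the block map `R × K → R × C`, identity on `R` and zero on `K`, where `R`, `K`, `C` are range,
kernel and a complement of the range. If `K ≅ C`, this is `id ⊕ 0`. The identity is handled by
companion matrices of `x² - x - 1` and `x³ - x - 1` unless `R` is a line; a line is paired with a
line of `K`, or, if `K = 0`, needs a scalar other than `0, 1, -1`. If `K ≇ C`, then `R` is
infinite-dimensional and at least as large as `K` and `C`. The map then splits into a backward shift
with kernel `K`, an injection with cokernel `C` (both admitting `S = 1`) and an identity. -/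

/-! ### Polynomial identities that force units -/

theorem isUnit_one_sub_and_one_add {A : Type*} [Ring A] {a : A} (h : IsUnit (1 - a * a)) :
    IsUnit (1 - a) ∧ IsUnit (1 + a) := by
  have c : Commute (1 - a) (1 + a) := by
    rw [commute_iff_eq]; noncomm_ring
  rw [← c.isUnit_mul_iff]
  convert h using 1
  noncomm_ring

/-- Here `1 - a² = -a`, and `a (a - 1) = 1`. -/
theorem isUnit_of_mul_self_eq_add_one {A : Type*} [Ring A] {a : A} (h : a * a = a + 1) :
    IsUnit a ∧ IsUnit (1 - a) ∧ IsUnit (1 + a) := by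
  have hu : IsUnit a :=
    ⟨⟨a, a - 1, by rw [mul_sub, h, mul_one, add_sub_cancel_left],
      by rw [sub_mul, h, one_mul, add_sub_cancel_left]⟩, rfl⟩
  refine ⟨hu, isUnit_one_sub_and_one_add ?_⟩
  rw [h, sub_add_cancel_right]
  exact hu.neg

theorem isUnit_of_mul_mul_self_eq_add_one {A : Type*} [Ring A] {a : A}
    (h : a * (a * a) = a + 1) : IsUnit a ∧ IsUnit (1 - a) ∧ IsUnit (1 + a) := by
  have c : Commute a (1 - a * a) :=
    (Commute.one_right a).sub_right ((Commute.refl a).mul_right (Commute.refl a))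
  have hu : IsUnit (a * (1 - a * a)) := by
    rw [mul_sub, h, mul_one, sub_add_cancel_left]
    exact isUnit_one.neg
  rw [c.isUnit_mul_iff] at hu
  exact ⟨hu.1, isUnit_one_sub_and_one_add hu.2⟩

/-! ### Block operations and small matrices -/

section Pencil

variable {R M N M' N' : Type*} [Ring R] [AddCommGroup M] [Module R M] [AddCommGroup N] [Module R N]
  [AddCommGroup M'] [Module R M'] [AddCommGroup N'] [Module R N']

/-- There is an invertible `S` such that `T - S` and `T + S` are both invertible. -/
def LinearMap.HasInvertibleShifts (T : M →ₗ[R] N) : Prop :=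
  ∃ S : M →ₗ[R] N, Function.Bijective S ∧ Function.Bijective (T - S) ∧ Function.Bijective (T + S)

namespace LinearMap.HasInvertibleShifts

theorem of_conj {T : M →ₗ[R] N} {T' : M' →ₗ[R] N'} (h : T'.HasInvertibleShifts)
    (e : M ≃ₗ[R] M') (f : N' ≃ₗ[R] N) (hT : ∀ x, T x = f (T' (e x))) :
    T.HasInvertibleShifts := by
  obtain ⟨S, h₁, h₂, h₃⟩ := h
  refine ⟨f.toLinearMap ∘ₗ S ∘ₗ e.toLinearMap, ?_, ?_, ?_⟩
  · exact (f.bijective.comp h₁).comp e.bijective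
  · convert (f.bijective.comp h₂).comp e.bijective using 1
    ext x
    simp [hT]
  · convert (f.bijective.comp h₃).comp e.bijective using 1
    ext x
    simp [hT]

theorem prodMap {T : M →ₗ[R] N} {T' : M' →ₗ[R] N'} (h : T.HasInvertibleShifts)
    (h' : T'.HasInvertibleShifts) : (LinearMap.prodMap T T').HasInvertibleShifts := by
  obtain ⟨S, h₁, h₂, h₃⟩ := h
  obtain ⟨S', h₁', h₂', h₃'⟩ := h'
  exact ⟨LinearMap.prodMap S S', h₁.prodMap h₁', h₂.prodMap h₂', h₃.prodMap h₃'⟩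

theorem zero_of_equiv (e : M ≃ₗ[R] N) : (0 : M →ₗ[R] N).HasInvertibleShifts := by
  refine ⟨e.toLinearMap, e.bijective, ?_, ?_⟩
  · convert (LinearEquiv.neg R (M := N)).bijective.comp e.bijective using 1
    ext x
    simp
  · simpa using e.bijective

theorem of_isUnit {T S : Module.End R M} (h₁ : IsUnit S) (h₂ : IsUnit (T - S))
    (h₃ : IsUnit (T + S)) : LinearMap.HasInvertibleShifts T :=
  ⟨S, (Module.End.isUnit_iff _).1 h₁, (Module.End.isUnit_iff _).1 h₂,
    (Module.End.isUnit_iff _).1 h₃⟩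

theorem id_congr (e : M ≃ₗ[R] N) (h : (LinearMap.id : N →ₗ[R] N).HasInvertibleShifts) :
    (LinearMap.id : M →ₗ[R] M).HasInvertibleShifts :=
  h.of_conj e e.symm fun x => by simp

theorem id_prod (h : (LinearMap.id : M →ₗ[R] M).HasInvertibleShifts)
    (h' : (LinearMap.id : N →ₗ[R] N).HasInvertibleShifts) :
    (LinearMap.id : (M × N) →ₗ[R] (M × N)).HasInvertibleShifts := by
  simpa using h.prodMap h'

theorem id_prod_self : (LinearMap.id : (M × M) →ₗ[R] (M × M)).HasInvertibleShifts := by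
  -- Companion matrix of `x² - x - 1`.
  let J : Module.End R (M × M) :=
    (LinearMap.snd R M M).prod (LinearMap.fst R M M + LinearMap.snd R M M)
  have hJ : J * J = J + 1 := by
    refine LinearMap.ext fun x => ?_
    ext <;> simp [J, add_comm, add_left_comm]
  obtain ⟨h₁, h₂, h₃⟩ := isUnit_of_mul_self_eq_add_one hJ
  exact of_isUnit h₁ h₂ h₃

theorem id_prod_self_prod_self :
    (LinearMap.id : (M × M × M) →ₗ[R] (M × M × M)).HasInvertibleShifts := by
  -- Companion matrix of `x³ - x - 1`.
  let J : Module.End R (M × M × M) :=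
    (LinearMap.fst R M M ∘ₗ LinearMap.snd R M (M × M)).prod
      ((LinearMap.snd R M M ∘ₗ LinearMap.snd R M (M × M)).prod
        (LinearMap.fst R M (M × M) + LinearMap.fst R M M ∘ₗ LinearMap.snd R M (M × M)))
  have hJ : J * (J * J) = J + 1 := by
    refine LinearMap.ext fun x => ?_
    ext <;> simp [J, add_comm]
  obtain ⟨h₁, h₂, h₃⟩ := isUnit_of_mul_mul_self_eq_add_one hJ
  exact of_isUnit h₁ h₂ h₃

theorem inl_comp_fst_self :
    (LinearMap.inl R M M ∘ₗ LinearMap.fst R M M).HasInvertibleShifts := by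
  let S : Module.End R (M × M) := (LinearMap.snd R M M).prod (LinearMap.fst R M M)
  let T : Module.End R (M × M) := LinearMap.inl R M M ∘ₗ LinearMap.fst R M M
  have hS : S * S = 1 := LinearMap.ext fun x => by ext <;> simp [S]
  have e : ∀ A B : Module.End R (M × M), A * B = 1 → B * A = 1 → IsUnit A :=
    fun A B h h' => ⟨⟨A, B, h, h'⟩, rfl⟩
  let Q : Module.End R (M × M) := LinearMap.inr R M M ∘ₗ LinearMap.snd R M M
  refine of_isUnit (T := T) (e S S hS hS) (e _ (-S - Q) ?_ ?_) (e _ (S - Q) ?_ ?_) <;>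
    exact LinearMap.ext fun x => by ext <;> simp [S, T, Q] <;> abel

end LinearMap.HasInvertibleShifts

theorem Module.End.isUnit_one_sub_of_locally_nilpotent (A : Module.End R M)
    (hA : ∀ x, ∃ n, (A ^ n) x = 0) : IsUnit (1 - A) := by
  rw [Module.End.isUnit_iff]
  constructor
  · rw [← LinearMap.ker_eq_bot, LinearMap.ker_eq_bot']
    intro x hx
    have hx' : A x = x := (sub_eq_zero.1 (by simpa using hx)).symm
    obtain ⟨n, hn⟩ := hA x
    have key : ∀ n, (A ^ n) x = x := fun n => by
      induction n with
      | zero => simp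
      | succ n ih => rw [pow_succ, Module.End.mul_apply, hx', ih]
    rw [← key n, hn]
  · intro y
    obtain ⟨n, hn⟩ := hA y
    refine ⟨(∑ i ∈ Finset.range n, A ^ i) y, ?_⟩
    rw [← Module.End.mul_apply, mul_neg_geom_sum]
    simp [hn]

/-! ### Shifts: models with unequal kernel and cokernel -/

/-- The backward shift `f ↦ (n ↦ f (n + 1))`. -/
noncomputable def Finsupp.backwardShift (R M : Type*) [Ring R] [AddCommGroup M] [Module R M] :
    Module.End R (ℕ →₀ M) :=
  Finsupp.lcomapDomain Nat.succ Nat.succ_injective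

@[simp] theorem Finsupp.backwardShift_apply (f : ℕ →₀ M) (n : ℕ) :
    Finsupp.backwardShift R M f n = f (n + 1) := rfl

theorem Finsupp.backwardShift_pow_apply (f : ℕ →₀ M) (k n : ℕ) :
    (Finsupp.backwardShift R M ^ k) f n = f (n + k) := by
  induction k generalizing n with
  | zero => simp
  | succ k ih =>
    rw [pow_succ', Module.End.mul_apply, Finsupp.backwardShift_apply, ih]
    congr 1
    omega

theorem Finsupp.exists_backwardShift_pow_eq_zero (f : ℕ →₀ M) :
    ∃ k, (Finsupp.backwardShift R M ^ k) f = 0 := by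
  obtain ⟨k, hk⟩ := f.support.exists_nat_subset_range
  refine ⟨k, Finsupp.ext fun n => ?_⟩
  rw [Finsupp.backwardShift_pow_apply]
  by_contra h
  have := Finset.mem_range.1 (hk (Finsupp.mem_support_iff.2 h))
  omega

theorem Finsupp.backwardShift_hasInvertibleShifts :
    (Finsupp.backwardShift R M).HasInvertibleShifts := by
  have h₁ := Module.End.isUnit_one_sub_of_locally_nilpotent _
    (Finsupp.exists_backwardShift_pow_eq_zero (R := R) (M := M))
  have h₂ := Module.End.isUnit_one_sub_of_locally_nilpotent (-Finsupp.backwardShift R M)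
    (fun f => by
      obtain ⟨k, hk⟩ := Finsupp.exists_backwardShift_pow_eq_zero (R := R) f
      exact ⟨k, by
        refine (LinearMap.congr_fun (neg_pow (R := Module.End R (ℕ →₀ M)) _ k) f).trans ?_
        rw [Module.End.mul_apply, hk, map_zero]⟩)
  refine LinearMap.HasInvertibleShifts.of_isUnit (S := 1) isUnit_one ?_ ?_
  · rw [← neg_sub]; exact h₁.neg
  · rwa [sub_neg_eq_add, add_comm] at h₂

/-- Splitting off coordinate `0` in the source turns the backward shift into this projection. -/
theorem Finsupp.fst_hasInvertibleShifts :
    (LinearMap.fst R (ℕ →₀ M) M).HasInvertibleShifts := by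
  have hb : Function.Bijective
      ((Finsupp.backwardShift R M).prod (Finsupp.lapply 0 : (ℕ →₀ M) →ₗ[R] M)) := by
    constructor
    · intro f g h
      obtain ⟨h₁, h₂⟩ := Prod.mk.inj h
      ext n
      cases n with
      | zero => exact h₂
      | succ n => simpa using DFunLike.congr_fun h₁ n
    · rintro ⟨f, m⟩
      refine ⟨Finsupp.embDomain ⟨Nat.succ, Nat.succ_injective⟩ f + Finsupp.single 0 m, ?_⟩
      have h0 : Finsupp.embDomain ⟨Nat.succ, Nat.succ_injective⟩ f 0 = 0 :=
        Finsupp.embDomain_of_notMem_range _ _ _ (by simp)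
      refine Prod.ext (Finsupp.ext fun n => ?_) ?_
      · have := Finsupp.embDomain_apply_self ⟨Nat.succ, Nat.succ_injective⟩ f n
        simp only [Function.Embedding.coeFn_mk] at this
        simp [this]
      · simp [h0]
  let e := LinearEquiv.ofBijective _ hb
  refine (Finsupp.backwardShift_hasInvertibleShifts (R := R) (M := M)).of_conj e.symm
    (LinearEquiv.refl R _) fun x => ?_
  obtain ⟨y, rfl⟩ := e.surjective x
  simp only [LinearEquiv.symm_apply_apply]
  rfl

/-- The two-sided shift `f ↦ (n ↦ f (n - 1))`. -/
noncomputable def Finsupp.intShift (R M : Type*) [Ring R] [AddCommGroup M] [Module R M] :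
    (ℤ →₀ M) ≃ₗ[R] (ℤ →₀ M) :=
  Finsupp.domLCongr (Equiv.addRight (1 : ℤ))

theorem Finsupp.intShift_apply (f : ℤ →₀ M) (n : ℤ) :
    Finsupp.intShift R M f n = f (n - 1) := by
  simp [Finsupp.intShift, Finsupp.domLCongr_apply, Finsupp.equivMapDomain_apply, sub_eq_add_neg]

theorem Finsupp.intShift_single (n : ℤ) (m : M) :
    Finsupp.intShift R M (Finsupp.single n m) = Finsupp.single (n + 1) m := by
  simp [Finsupp.intShift]

/-- This says that `1 - intShift` is injective with cokernel `M`, represented by coordinate `0`. -/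
theorem Finsupp.sub_intShift_coprod_single_bijective :
    Function.Bijective (((1 : Module.End R (ℤ →₀ M)) - (Finsupp.intShift R M).toLinearMap).coprod
      (Finsupp.lsingle (R := R) (0 : ℤ))) := by
  constructor
  · rw [← LinearMap.ker_eq_bot, LinearMap.ker_eq_bot']
    rintro ⟨f, m⟩ h
    simp only [LinearMap.coprod_apply, LinearMap.sub_apply, Module.End.one_apply,
      LinearEquiv.coe_coe, Finsupp.lsingle_apply] at h
    -- The sum of coordinates is shift-invariant, so it kills the image of `1 - intShift`.
    let s : (ℤ →₀ M) →ₗ[R] M := Finsupp.lsum ℕ fun _ => LinearMap.id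
    have hs : s ∘ₗ (Finsupp.intShift R M).toLinearMap = s := by
      refine Finsupp.lhom_ext fun n x => ?_
      simp [s, Finsupp.intShift_single]
    have hm : m = 0 := by
      have := congrArg s h
      have h' : s (Finsupp.intShift R M f) = s f := LinearMap.congr_fun hs f
      rw [map_add, map_sub, h', sub_self, zero_add, map_zero] at this
      simpa [s] using this
    subst hm
    rw [Finsupp.single_zero, add_zero, sub_eq_zero] at h
    -- A shift-invariant `f` is constant, hence zero by finite support.
    have hc : ∀ n, f n = f (n - 1) := fun n => by
      rw [← Finsupp.intShift_apply (R := R), ← h]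
    have hc' : ∀ n, f n = f 0 := fun n => by
      induction n using Int.induction_on with
      | zero => rfl
      | succ i ih => rw [hc, add_sub_cancel_right, ih]
      | pred i ih => rw [← hc, ih]
    obtain ⟨n, hn⟩ := Infinite.exists_notMem_finset f.support
    have h0 : f 0 = 0 := by rw [← hc' n]; simpa using hn
    exact Prod.ext (Finsupp.ext fun n => by rw [hc', h0]; rfl) rfl
  · rw [← LinearMap.range_eq_top, eq_top_iff]
    set P := LinearMap.range (((1 : Module.End R (ℤ →₀ M)) -
      (Finsupp.intShift R M).toLinearMap).coprod (Finsupp.lsingle (R := R) (0 : ℤ)))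
    have hd : ∀ n m, Finsupp.single n m - Finsupp.single (n + 1) m ∈ P := fun n m =>
      ⟨(Finsupp.single n m, 0), by simp [Finsupp.intShift_single]⟩
    have h0 : ∀ n m, Finsupp.single n m ∈ P := fun n m => by
      induction n using Int.induction_on with
      | zero => exact ⟨(0, m), by simp⟩
      | succ i ih => exact (Submodule.sub_mem_iff_right _ ih).1 (hd i m)
      | pred i ih =>
        have := hd (-i - 1) m
        rw [sub_add_cancel] at this
        exact (Submodule.sub_mem_iff_left _ ih).1 this
    intro f _
    induction f using Finsupp.induction_linear with
    | zero => exact P.zero_mem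
    | add f g hf hg => exact P.add_mem (hf trivial) (hg trivial)
    | single n m => exact h0 n m

/-- `A (x, y) = (D y, x)` is a square root of `D ⊕ D`, so `1 - A²` is the shift on each factor and
`S = 1` works for `A`. Like `D`, `A` is injective with cokernel `M`, so it is equivalent to `inl`.
-/
theorem Finsupp.inl_hasInvertibleShifts :
    (LinearMap.inl R ((ℤ →₀ M) × (ℤ →₀ M)) M).HasInvertibleShifts := by
  let D : Module.End R (ℤ →₀ M) := 1 - (Finsupp.intShift R M).toLinearMap
  let A : Module.End R ((ℤ →₀ M) × (ℤ →₀ M)) :=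
    (D ∘ₗ LinearMap.snd R _ _).prod (LinearMap.fst R _ _)
  have hu : IsUnit (1 - A * A) := by
    have : 1 - A * A =
        ((Finsupp.intShift R M).prodCongr (Finsupp.intShift R M)).toLinearMap := by
      refine LinearMap.ext fun x => ?_
      ext <;> simp [A, D]
    rw [this, Module.End.isUnit_iff]
    exact LinearEquiv.bijective _
  replace hu := isUnit_one_sub_and_one_add hu
  have hA : A.HasInvertibleShifts := by
    refine LinearMap.HasInvertibleShifts.of_isUnit (S := 1) isUnit_one ?_ (add_comm A 1 ▸ hu.2)
    rw [← neg_sub]; exact hu.1.neg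
  let g := LinearEquiv.ofBijective _ (Finsupp.sub_intShift_coprod_single_bijective (R := R) (M := M))
  let k : (((ℤ →₀ M) × (ℤ →₀ M)) × M) ≃ₗ[R] ((ℤ →₀ M) × (ℤ →₀ M)) :=
    LinearEquiv.prodAssoc R _ _ _ ≪≫ₗ
      (LinearEquiv.refl R _).prodCongr g ≪≫ₗ LinearEquiv.prodComm R _ _
  refine hA.of_conj (LinearEquiv.refl R _) k.symm fun x => ?_
  rw [LinearEquiv.eq_symm_apply]
  ext <;> simp [k, g, A, D]

end Pencil

/-! ### Vector spaces: reduction by rank -/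

section VectorSpace

variable {E : Type u} [DivisionRing E]
  {W K C : Type v} [AddCommGroup W] [Module E W] [AddCommGroup K] [Module E K]
  [AddCommGroup C] [Module E C]

theorem LinearMap.exists_eq_inl_comp_fst (T : W →ₗ[E] W) :
    ∃ (K Q : Submodule E W) (e : W ≃ₗ[E] LinearMap.range T × K)
      (f : (LinearMap.range T × Q) ≃ₗ[E] W), ∀ x, T x = f ((e x).1, 0) := by
  obtain ⟨P, hP⟩ := (LinearMap.ker T).exists_isCompl
  obtain ⟨Q, hQ⟩ := (LinearMap.range T).exists_isCompl
  let p := Submodule.prodEquivOfIsCompl P (LinearMap.ker T) hP.symm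
  let r := T.kerComplementEquivRange hP.symm
  refine ⟨LinearMap.ker T, Q, p.symm ≪≫ₗ r.prodCongr (LinearEquiv.refl E _),
    Submodule.prodEquivOfIsCompl _ _ hQ, fun x => ?_⟩
  obtain ⟨⟨a, b⟩, rfl⟩ := p.surjective x
  simp [p, r, LinearMap.kerComplementEquivRange]

namespace LinearMap.HasInvertibleShifts

theorem id_of_ne {a : E} (h₀ : a ≠ 0) (h₁ : a ≠ 1) (h₂ : a ≠ -1) :
    (LinearMap.id : E →ₗ[E] E).HasInvertibleShifts := by
  have hb : ∀ b : E, b ≠ 0 → Function.Bijective (LinearMap.toSpanSingleton E E b) := fun b hb =>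
    ⟨fun x y h => mul_right_cancel₀ hb (by simpa using h), fun y => ⟨y * b⁻¹, by simp [hb]⟩⟩
  refine ⟨LinearMap.toSpanSingleton E E a, hb a h₀, ?_, ?_⟩
  · convert hb (1 - a) (sub_ne_zero.2 h₁.symm) using 1
    ext
    simp [mul_sub]
  · convert hb (1 + a) (fun h => h₂ (eq_neg_of_add_eq_zero_right h)) using 1
    ext
    simp [mul_add]

theorem id_of_rank_ne_one (h : Module.rank E W ≠ 1) :
    (LinearMap.id : W →ₗ[E] W).HasInvertibleShifts := by
  rcases lt_or_ge (Module.rank E W) ℵ₀ with hf | hi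
  · have : Module.Finite E W := Module.rank_lt_aleph0_iff.1 hf
    have hn : Module.finrank E W ≠ 1 := fun hn => h (by rw [← Module.finrank_eq_rank, hn]; simp)
    have key : ∀ (X : Type u) [AddCommGroup X] [Module E X] [Module.Finite E X],
        (LinearMap.id : X →ₗ[E] X).HasInvertibleShifts → Module.finrank E W = Module.finrank E X →
        (LinearMap.id : W →ₗ[E] W).HasInvertibleShifts := fun X _ _ _ hX hr => by
      obtain ⟨e⟩ := FiniteDimensional.nonempty_linearEquiv_of_finrank_eq hr
      exact id_congr e hX
    rcases Nat.even_or_odd' (Module.finrank E W) with ⟨m, hm | hm⟩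
    · exact key ((Fin m → E) × (Fin m → E)) id_prod_self (by simp [hm, two_mul])
    -- An odd dimension other than `1` is `2k + 3`: two blocks of size `k` and one triple.
    · obtain ⟨k, rfl⟩ : ∃ k, m = k + 1 := Nat.exists_eq_succ_of_ne_zero (by omega)
      exact key (((Fin k → E) × (Fin k → E)) × (E × E × E))
        (id_prod id_prod_self id_prod_self_prod_self) (by simp [hm]; omega)
  · obtain ⟨e⟩ : Nonempty (W ≃ₗ[E] W × W) :=
      nonempty_linearEquiv_of_rank_eq (by rw [rank_prod', add_eq_self hi])
    exact id_congr e id_prod_self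

theorem inl_comp_fst_of_id (h : (LinearMap.id : W →ₗ[E] W).HasInvertibleShifts) (e : K ≃ₗ[E] C) :
    (LinearMap.inl E W C ∘ₗ LinearMap.fst E W K).HasInvertibleShifts :=
  (h.prodMap (zero_of_equiv e)).of_conj (LinearEquiv.refl E _) (LinearEquiv.refl E _)
    fun x => by ext <;> simp

theorem inl_comp_fst_of_rank_eq_one (h : Module.rank E W = 1) (hK : 1 ≤ Module.rank E K)
    (e : K ≃ₗ[E] C) : (LinearMap.inl E W C ∘ₗ LinearMap.fst E W K).HasInvertibleShifts := by
  obtain ⟨i, hi⟩ := rank_le_iff_exists_linearMap.1 (h.trans_le hK)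
  obtain ⟨Q, hQ⟩ := (LinearMap.range i).exists_isCompl
  let φ : (W × Q) ≃ₗ[E] K := (LinearEquiv.ofInjective i hi).prodCongr (LinearEquiv.refl E Q) ≪≫ₗ
    Submodule.prodEquivOfIsCompl _ _ hQ
  have hs := (inl_comp_fst_self (R := E) (M := W)).prodMap (zero_of_equiv (LinearEquiv.refl E Q))
  exact hs.of_conj
    ((LinearEquiv.refl E W).prodCongr φ.symm ≪≫ₗ (LinearEquiv.prodAssoc E W W Q).symm)
    (LinearEquiv.prodAssoc E W W Q ≪≫ₗ (LinearEquiv.refl E W).prodCongr (φ ≪≫ₗ e))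
    fun x => Prod.ext rfl ((map_zero (φ ≪≫ₗ e)).symm)

theorem inl_comp_fst_of_rank_le (hW : ℵ₀ ≤ Module.rank E W)
    (hK : Module.rank E K ≤ Module.rank E W) (hC : Module.rank E C ≤ Module.rank E W) :
    (LinearMap.inl E W C ∘ₗ LinearMap.fst E W K).HasInvertibleShifts := by
  have hω : ∀ c ≤ Module.rank E W, ℵ₀ * c ≤ Module.rank E W := fun c hc =>
    (mul_le_mul' hW hc).trans (mul_eq_self hW).le
  -- `W` absorbs countably many copies of `K` and `C`, making room for both shift models.
  obtain ⟨φ⟩ : Nonempty (W ≃ₗ[E] (ℕ →₀ K) × ((ℤ →₀ C) × (ℤ →₀ C)) × W) := by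
    refine nonempty_linearEquiv_of_rank_eq ?_
    simp only [rank_prod', rank_finsupp, mk_eq_aleph0, lift_aleph0, lift_uzero]
    rw [add_eq_right (a := _ + _) hW (add_le_of_le hW (hω _ hC) (hω _ hC)),
      add_eq_right hW (hω _ hK)]
  have hid : (LinearMap.id : W →ₗ[E] W).HasInvertibleShifts :=
    id_of_rank_ne_one (one_lt_aleph0.trans_le hW).ne'
  have hp := (Finsupp.fst_hasInvertibleShifts (R := E) (M := K)).prodMap
    ((Finsupp.inl_hasInvertibleShifts (R := E) (M := C)).prodMap hid)
  let e : (((ℕ →₀ K) × ((ℤ →₀ C) × (ℤ →₀ C)) × W) × K) ≃ₗ[E]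
      (((ℕ →₀ K) × K) × ((ℤ →₀ C) × (ℤ →₀ C)) × W) :=
    { toFun := fun x => ((x.1.1, x.2), x.1.2)
      invFun := fun x => ((x.1.1, x.2), x.1.2)
      map_add' := fun _ _ => rfl
      map_smul' := fun _ _ => rfl }
  let f : ((ℕ →₀ K) × (((ℤ →₀ C) × (ℤ →₀ C)) × C) × W) ≃ₗ[E]
      (((ℕ →₀ K) × ((ℤ →₀ C) × (ℤ →₀ C)) × W) × C) :=
    { toFun := fun x => ((x.1, x.2.1.1, x.2.2), x.2.1.2)
      invFun := fun x => (x.1.1, (x.1.2.1, x.2), x.1.2.2)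
      map_add' := fun _ _ => rfl
      map_smul' := fun _ _ => rfl }
  exact hp.of_conj (φ.prodCongr (LinearEquiv.refl E K) ≪≫ₗ e)
    (f ≪≫ₗ φ.symm.prodCongr (LinearEquiv.refl E C)) fun x => by ext <;> simp [e, f]

end LinearMap.HasInvertibleShifts

/-- Except in the one-dimensional case over a division ring with at most three elements, every
endomorphism has invertible shifts. -/
theorem LinearMap.hasInvertibleShifts
    (h : ¬ (Module.rank E W = 1 ∧ ∀ a : E, a = 0 ∨ a = 1 ∨ a = -1)) (T : W →ₗ[E] W) :
    T.HasInvertibleShifts := by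
  obtain ⟨K, C, e, f, hT⟩ := T.exists_eq_inl_comp_fst
  refine LinearMap.HasInvertibleShifts.of_conj
    (T' := LinearMap.inl E (LinearMap.range T) C ∘ₗ LinearMap.fst E (LinearMap.range T) K)
    ?_ e f hT
  have he := e.rank_eq
  have hf := f.rank_eq
  rw [rank_prod'] at he hf
  by_cases hKC : Module.rank E K = Module.rank E C
  · obtain ⟨k⟩ := nonempty_linearEquiv_of_rank_eq hKC
    by_cases hr : Module.rank E (LinearMap.range T) = 1
    · by_cases hK : 1 ≤ Module.rank E K
      · exact .inl_comp_fst_of_rank_eq_one hr hK k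
      · rw [Cardinal.one_le_iff_ne_zero, not_not] at hK
        rw [hK, add_zero, hr] at he
        simp only [he, true_and, not_forall, not_or] at h
        obtain ⟨a, h₀, h₁, h₂⟩ := h
        refine .inl_comp_fst_of_id ?_ k
        obtain ⟨g⟩ : Nonempty (LinearMap.range T ≃ₗ[E] E) :=
          nonempty_linearEquiv_of_lift_rank_eq (by simp [hr])
        exact (LinearMap.HasInvertibleShifts.id_of_ne h₀ h₁ h₂).id_congr g
    · exact .inl_comp_fst_of_id (.id_of_rank_ne_one hr) k
  · rw [← hf] at he
    -- A finite rank could be cancelled from `he`, giving `K ≅ C`.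
    have hi : ℵ₀ ≤ Module.rank E (LinearMap.range T) := by
      by_contra hlt
      exact hKC (Cardinal.eq_of_add_eq_add_left he (not_le.1 hlt)).symm
    rw [add_eq_max hi, add_eq_max hi] at he
    refine .inl_comp_fst_of_rank_le hi ?_ ?_ <;> grind

/-- On a line `S` acts on a generator `v` as `0`, `1` or `-1`, so one of the three maps kills `v`.
-/
theorem Module.exists_not_isUnit_of_rank_eq_one (h : Module.rank E W = 1)
    (hE : ∀ a : E, a = 0 ∨ a = 1 ∨ a = -1) (S : Module.End E W) :
    ¬ (IsUnit S ∧ IsUnit (1 - S) ∧ IsUnit (1 + S)) := by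
  obtain ⟨v, hv, hs⟩ := rank_eq_one_iff.1 h
  simp only [Module.End.isUnit_iff]
  have key : ∀ A : Module.End E W, Function.Bijective A → A v ≠ 0 := fun A hA h0 =>
    hv (hA.1 (h0.trans (map_zero A).symm))
  rintro ⟨h₁, h₂, h₃⟩
  obtain ⟨a, ha⟩ := hs (S v)
  rcases hE a with rfl | rfl | rfl
  · exact key S h₁ (by simp [← ha])
  · exact key (1 - S) h₂ (by simp [← ha])
  · exact key (1 + S) h₃ (by simp [← ha])

theorem DivisionRing.nonempty_ringEquiv_zmod_iff :
    (Nonempty (E ≃+* ZMod 2) ∨ Nonempty (E ≃+* ZMod 3)) ↔ ∀ a : E, a = 0 ∨ a = 1 ∨ a = -1 := by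
  classical
  constructor
  · have h₂ : ∀ a : ZMod 2, a = 0 ∨ a = 1 ∨ a = -1 := by decide
    have h₃ : ∀ a : ZMod 3, a = 0 ∨ a = 1 ∨ a = -1 := by decide
    rintro (⟨⟨e⟩⟩ | ⟨⟨e⟩⟩) a
    · simpa only [← e.injective.eq_iff, map_zero, map_one, map_neg] using h₂ (e a)
    · simpa only [← e.injective.eq_iff, map_zero, map_one, map_neg] using h₃ (e a)
  · intro h
    let _ : Fintype E := ⟨{0, 1, -1}, by simpa using h⟩
    have hc : Fintype.card E = ({0, 1, -1} : Finset E).card := rfl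
    by_cases h2 : (1 : E) = -1
    -- The set `{0, 1, -1}` has two or three elements according to whether `1 = -1`; a ring of prime
    -- cardinality is `ZMod p`.
    · refine .inl ⟨(ZMod.ringEquivOfPrime E Nat.prime_two ?_).symm⟩
      rw [hc, ← h2]
      simp
    · refine .inr ⟨(ZMod.ringEquivOfPrime E Nat.prime_three ?_).symm⟩
      rw [hc, Finset.card_eq_three]
      exact ⟨0, 1, -1, by simp, by simp, h2, rfl⟩

end VectorSpace

theorem mainTheorem5 {D : Type*} [DivisionRing D] {V : Type*} [AddCommGroup V] [Module Dᵐᵒᵖ V] :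
    (∀ T : V →ₗ[Dᵐᵒᵖ] V, ∃ S : V →ₗ[Dᵐᵒᵖ] V, IsUnit S ∧ IsUnit (T - S) ∧ IsUnit (T + S)) ↔
      ¬ (Module.rank Dᵐᵒᵖ V = 1 ∧ (Nonempty (D ≃+* ZMod 2) ∨ Nonempty (D ≃+* ZMod 3))) := by
  -- Right `D`-spaces are left `Dᵐᵒᵖ`-modules; the condition on scalars is the same for both rings.
  have hD : (∀ a : Dᵐᵒᵖ, a = 0 ∨ a = 1 ∨ a = -1) ↔ ∀ a : D, a = 0 ∨ a = 1 ∨ a = -1 :=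
    ⟨fun h a => (h (.op a)).imp MulOpposite.op_injective.eq_iff.1
        (.imp MulOpposite.op_injective.eq_iff.1 MulOpposite.op_injective.eq_iff.1),
      fun h a => (h a.unop).imp MulOpposite.unop_injective.eq_iff.1
        (.imp MulOpposite.unop_injective.eq_iff.1 MulOpposite.unop_injective.eq_iff.1)⟩
  rw [DivisionRing.nonempty_ringEquiv_zmod_iff, ← hD]
  constructor
  · rintro h ⟨hr, ha⟩
    obtain ⟨S, hS⟩ := h 1
    exact Module.exists_not_isUnit_of_rank_eq_one hr ha S hS
  · intro h T
    obtain ⟨S, h₁, h₂, h₃⟩ := LinearMap.hasInvertibleShifts h T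
    exact ⟨S, (Module.End.isUnit_iff _).2 h₁, (Module.End.isUnit_iff _).2 h₂,
      (Module.End.isUnit_iff _).2 h₃⟩
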